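/- Say that points $p_1,\dots,p_m\in\mathbb R^d$ realise an angle $\theta$ if there are points $A,B,C$ among them, with $A\neq B$ and $C\neq B$, such that $\angle ABC=\theta$. Let $m\ge 2$ and $n=2m-3$. Then there exists a set of $n$ distinct angles in $(0,\pi)$ such that, for every dimension $d$, no arrangement of $m$ points in $\mathbb R^d$ realises all the angles in the set. -/

import Mathlib

/-- The angle `θ` is realised by the family of points `p` in `ℝ^d`: there are points `A = p i`,
`B = p j`, `C = p k` of the family, with `A ≠ B` and `C ≠ B` (so that the rays `BA` and `BC` exist),
such that the (undirected) angle `ABC` at `B` equals `θ`. -/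
def RealisesAngle {m d : ℕ} (p : Fin m → EuclideanSpace ℝ (Fin d)) (θ : ℝ) : Prop :=
  ∃ i j k : Fin m, p i ≠ p j ∧ p k ≠ p j ∧ EuclideanGeometry.angle (p i) (p j) (p k) = θ

/-! Take angles whose sines have widely separated orders of magnitude. Two linear functionals
project any arrangement to the plane so that each difference of slopes at a vertex equals the sine
of the angle there up to factors depending only on m (`exists_planar_projection`).

Slope differences survive shears, translations and homotheties, so two points can be put at (0, 0)
and (1, 0), leaving 2m - 4 parameters. Hence 2m - 3 slope differences satisfy a nontrivial
polynomial relation, and a product over all choices of triples gives one Q depending only on m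
(`exists_universal_slopeDiff_relation`).

The factors and Q are fixed before the angles, so the sines can be separated enough that Q has no
zero within those factors of them (`exists_separated_scales`). -/

/-! ### Algebraic dependence and zeros of polynomials -/

open MvPolynomial in
/-- More rational functions than variables satisfy a nontrivial polynomial relation, which may be
evaluated wherever the denominators do not vanish. -/
theorem exists_relation_of_card_lt {K σ : Type} [Field K] [Fintype σ] {n : ℕ}
    (hn : Fintype.card σ < n) (N D : Fin n → MvPolynomial σ K) :
    ∃ Q : MvPolynomial (Fin n) K, Q ≠ 0 ∧ ∀ x : σ → K, (∀ i, eval x (D i) ≠ 0) →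
      eval (fun i => eval x (N i) / eval x (D i)) Q = 0 := by
  let R := MvPolynomial σ K
  let F := FractionRing R
  let f : Fin n → F := fun i => algebraMap R F (N i) / algebraMap R F (D i)
  have : Algebra.IsAlgebraic R F := IsLocalization.isAlgebraic F (nonZeroDivisors R)
  have htr : Algebra.trdeg K F = (Fintype.card σ : Cardinal) := by
    have := trdeg_add_eq K R (A := F)
    rw [← this, trdeg_eq_zero (R := R) (A := F), MvPolynomial.trdeg_of_isDomain]
    simp
  have hdep : ¬ AlgebraicIndependent K f := by
    intro h
    have := h.cardinalMk_le_trdeg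
    rw [htr, Cardinal.mk_fin] at this
    exact absurd (by exact_mod_cast this) (not_le.mpr hn)
  rw [algebraicIndependent_iff] at hdep
  push Not at hdep
  obtain ⟨Q, hQ, hQ0⟩ := hdep
  refine ⟨Q, hQ0, fun x hx => ?_⟩
  -- Evaluation at `x` does not extend to `F`. It does extend to the local ring at its kernel, which
  -- contains the fractions and embeds in `F`, so the relation descends there.
  let P : Ideal R := RingHom.ker (eval x)
  have : P.IsPrime := RingHom.ker_isPrime _
  let L := Localization P.primeCompl
  let ev : L →ₐ[K] K := IsLocalization.liftAlgHom (M := P.primeCompl) (f := aeval x) (by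
    rintro ⟨y, hy⟩
    exact isUnit_iff_ne_zero.mpr fun h => hy (RingHom.mem_ker.mpr h))
  let inc : L →ₐ[K] F := IsLocalization.liftAlgHom (M := P.primeCompl)
    (f := IsScalarTower.toAlgHom K R F) (by
    rintro ⟨y, hy⟩
    refine isUnit_iff_ne_zero.mpr fun h => hy ?_
    have : y = 0 := (IsFractionRing.injective R F) (by simpa using h)
    simp [this])
  have hinc : Function.Injective inc := by
    refine (IsLocalization.lift_injective_iff _).mpr fun y z => ?_
    rw [(IsLocalization.injective L P.primeCompl_le_nonZeroDivisors).eq_iff]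
    exact (IsFractionRing.injective R F).eq_iff.symm
  have hD : ∀ i, D i ∈ P.primeCompl := fun i h => hx i (by simpa [P, RingHom.mem_ker] using h)
  let g : Fin n → L := fun i => IsLocalization.mk' L (N i) ⟨D i, hD i⟩
  have hg : ∀ i, g i * algebraMap R L (D i) = algebraMap R L (N i) :=
    fun i => IsLocalization.mk'_spec L (N i) ⟨D i, hD i⟩
  have hincR : ∀ y : R, inc (algebraMap R L y) = algebraMap R F y :=
    fun y => IsLocalization.lift_eq _ y
  have hevR : ∀ y : R, ev (algebraMap R L y) = eval x y := fun y => by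
    exact IsLocalization.lift_eq _ y
  have hgf : ∀ i, inc (g i) = f i := fun i => by
    have hne : algebraMap R F (D i) ≠ 0 := fun h => hx i (by
      rw [(IsFractionRing.injective R F) (h.trans (map_zero _).symm), map_zero])
    rw [eq_div_iff hne, ← hincR, ← hincR, ← map_mul, hg]
  have hge : ∀ i, ev (g i) = eval x (N i) / eval x (D i) := fun i => by
    rw [eq_div_iff (hx i), ← hevR, ← hevR, ← map_mul, hg]
  have h0 : aeval g Q = 0 := hinc (by
    rw [map_zero, ← hQ, comp_aeval_apply]
    simp only [hgf])
  have h1 := congrArg ev h0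
  rw [map_zero, comp_aeval_apply] at h1
  simp only [hge] at h1
  exact h1

open MvPolynomial in
/-- A nonzero polynomial does not vanish at points whose coordinates have sufficiently separated
orders of magnitude. -/
theorem exists_separated_scales (a b : ℝ) (ha : 0 < a) {n : ℕ} (Q : MvPolynomial (Fin n) ℝ)
    (hQ : Q ≠ 0) :
    ∃ e : Fin n → ℝ, Function.Injective e ∧ (∀ i, 0 < e i ∧ e i < 1) ∧
      ∀ s : Fin n → ℝ, (∀ i, a * e i ≤ |s i| ∧ |s i| ≤ b * e i) → eval s Q ≠ 0 := by
  induction n with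
  | zero =>
    refine ⟨Fin.elim0, fun i => i.elim0, fun i => i.elim0, fun s _ h => hQ ?_⟩
    rw [eq_C_of_isEmpty Q] at h ⊢
    rw [eval_C] at h
    rw [h, C_0]
  | succ n ih =>
    set p := finSuccEquiv ℝ n Q with hp
    have hp0 : p ≠ 0 := (map_ne_zero_iff _ (finSuccEquiv ℝ n).injective).mpr hQ
    -- With the power of the first variable removed, the constant coefficient is nonzero and the
    -- induction applies to it.
    obtain ⟨r, hr, hrX⟩ := p.exists_eq_pow_rootMultiplicity_mul_and_not_dvd hp0 0
    rw [Polynomial.C_0, sub_zero] at hr hrX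
    rw [Polynomial.X_dvd_iff] at hrX
    obtain ⟨e, hinj, he, hs⟩ := ih _ hrX
    let K : Set (Fin n → ℝ) := Set.univ.pi fun i => {t | a * e i ≤ |t| ∧ |t| ≤ b * e i}
    have hK : IsCompact K := by
      refine isCompact_univ_pi fun i => ?_
      refine Metric.isCompact_of_isClosed_isBounded ?_ ?_
      · exact (isClosed_le continuous_const continuous_abs).inter
          (isClosed_le continuous_abs continuous_const)
      · refine (Metric.isBounded_closedBall (x := (0 : ℝ)) (r := b * e i)).subset fun t ht => ?_
        simpa using ht.2
    let G : ℝ → (Fin n → ℝ) → ℝ := fun y s => (r.map (eval s)).eval y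
    have hG : Continuous fun z : ℝ × (Fin n → ℝ) => G z.1 z.2 := by
      have : (fun z : ℝ × (Fin n → ℝ) => G z.1 z.2) = fun z =>
          eval (Fin.cons z.1 z.2 : Fin (n + 1) → ℝ) ((finSuccEquiv ℝ n).symm r) := by
        funext z
        rw [eval_eq_eval_mv_eval', AlgEquiv.apply_symm_apply]
      rw [this]
      exact (MvPolynomial.continuous_eval _).comp (by fun_prop)
    -- Compactness of `K` makes one bound on the first coordinate serve all `s`.
    have hev : ∀ᶠ y in nhds (0 : ℝ), ∀ s ∈ K, G y s ≠ 0 := by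
      refine hK.eventually_forall_of_forall_eventually fun s hsK => ?_
      refine hG.continuousAt.eventually_ne ?_
      simp only [G, ← Polynomial.coeff_zero_eq_eval_zero, Polynomial.coeff_map]
      exact hs s fun i => hsK i trivial
    obtain ⟨δ, hδ, hball⟩ := Metric.eventually_nhds_iff.mp hev
    have hsmall : ∀ᶠ t in nhdsWithin (0 : ℝ) (Set.Ioi 0),
        (b * t < δ ∧ t < 1 ∧ ∀ i, t < e i) ∧ 0 < t := by
      refine Filter.Eventually.and (nhdsWithin_le_nhds ?_) self_mem_nhdsWithin
      refine Filter.Eventually.and ?_ (Filter.Eventually.and ?_ (Filter.eventually_all.mpr fun i => ?_))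
      · have : Continuous fun t : ℝ => b * t := by fun_prop
        exact this.continuousAt.eventually_lt continuousAt_const (by simpa using hδ)
      · exact eventually_lt_nhds one_pos
      · exact eventually_lt_nhds (he i).1
    obtain ⟨t, ⟨htδ, ht1, hte⟩, ht0⟩ := hsmall.exists
    refine ⟨Fin.cons t e, ?_, ?_, ?_⟩
    · exact Fin.cons_injective_iff.mpr ⟨fun ⟨i, hi⟩ => (hte i).ne' hi, hinj⟩
    · intro i
      refine Fin.cases ?_ (fun i => ?_) i
      · simpa using ⟨ht0, ht1⟩
      · simpa using he i
    · intro s h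
      rw [← Fin.cons_self_tail s, eval_eq_eval_mv_eval', ← hp, hr, Polynomial.map_mul,
        Polynomial.map_pow, Polynomial.map_X, Polynomial.eval_mul, Polynomial.eval_pow,
        Polynomial.eval_X]
      have h0 := h 0
      rw [Fin.cons_zero] at h0
      refine mul_ne_zero (pow_ne_zero _ fun hz => ?_) (hball ?_ _ fun i _ => ?_)
      · rw [hz, abs_zero] at h0
        exact absurd h0.1 (not_le.mpr (mul_pos ha ht0))
      · rw [Real.dist_0_eq_abs]
        exact h0.2.trans_lt htδ
      · simpa [Fin.tail] using h i.succ

/-! ### Projection to the plane -/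

/-- Finitely many vectors have a common direction that is uniformly far from orthogonal to each of
them, with a bound depending only on the number of vectors. -/
theorem exists_uniform_functional_finset (N : ℕ) :
    ∃ c : ℝ, 0 < c ∧ ∀ {E : Type} [NormedAddCommGroup E] [InnerProductSpace ℝ E] (s : Finset E),
      s.card ≤ N → ∃ a : E, ‖a‖ ≤ 1 ∧ ∀ u ∈ s, c * ‖u‖ ≤ |inner ℝ a u| := by
  induction N with
  | zero =>
    refine ⟨1, one_pos, fun s hs => ⟨0, by simp, fun u hu => ?_⟩⟩
    rw [Finset.card_eq_zero.mp (Nat.le_zero.mp hs)] at hu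
    simp at hu
  | succ N ih =>
    obtain ⟨c, hc, H⟩ := ih
    have hmin : 0 < min c 1 := lt_min hc one_pos
    refine ⟨min c 1 / 8, by positivity, fun {E} _ _ s hs => ?_⟩
    classical
    rcases s.eq_empty_or_nonempty with rfl | ⟨u, hu⟩
    · exact ⟨0, by simp, by simp⟩
    obtain ⟨a, ha, hau⟩ := H (s.erase u) (by rw [Finset.card_erase_of_mem hu]; omega)
    have hmc : min c 1 ≤ c := min_le_left _ _
    have hm1 : min c 1 ≤ 1 := min_le_right _ _
    set k := min c 1
    by_cases hsmall : k / 8 * ‖u‖ ≤ |inner ℝ a u|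
    · refine ⟨a, ha, fun v hv => ?_⟩
      by_cases hvu : v = u
      · rwa [hvu]
      · have := hau v (Finset.mem_erase.mpr ⟨hvu, hv⟩)
        nlinarith [norm_nonneg v]
    · push Not at hsmall
      have hun : 0 < ‖u‖ := by
        by_contra h
        have : ‖u‖ = 0 := le_antisymm (not_lt.mp h) (norm_nonneg u)
        rw [this, mul_zero] at hsmall
        exact absurd hsmall (not_lt.mpr (abs_nonneg _))
      set w := (1 / ‖u‖) • u
      have hw : ‖w‖ = 1 := by simp [w, norm_smul, hun.ne']
      have hwu : inner ℝ w u = ‖u‖ := by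
        simp only [w, real_inner_smul_left, real_inner_self_eq_norm_sq]
        field_simp
      -- Tilting `a` towards `u` costs the other vectors at most half of their bound; the factor 1/2
      -- restores norm at most 1.
      refine ⟨(1 / 2 : ℝ) • (a + (k / 2) • w), ?_, fun v hv => ?_⟩
      · have h1 : ‖a + (k / 2) • w‖ ≤ ‖a‖ + k / 2 := by
          refine (norm_add_le _ _).trans_eq ?_
          rw [norm_smul, hw, mul_one, Real.norm_of_nonneg (by positivity)]
        rw [norm_smul, Real.norm_of_nonneg (by norm_num)]
        linarith
      · have hval : inner ℝ ((1 / 2 : ℝ) • (a + (k / 2) • w)) v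
            = (1 / 2) * (inner ℝ a v + k / 2 * inner ℝ w v) := by
          simp only [real_inner_smul_left, inner_add_left]
        rw [hval, abs_mul, abs_of_pos (by norm_num : (0 : ℝ) < 1 / 2)]
        by_cases hvu : v = u
        · subst hvu
          rw [hwu]
          have := (abs_lt.mp hsmall).1
          have h2 := le_abs_self (inner ℝ a v + k / 2 * ‖v‖)
          nlinarith
        · have h1 := hau v (Finset.mem_erase.mpr ⟨hvu, hv⟩)
          have h2 : |k / 2 * inner ℝ w v| ≤ k / 2 * ‖v‖ := by
            rw [abs_mul, abs_of_pos (by positivity)]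
            have := abs_real_inner_le_norm w v
            rw [hw, one_mul] at this
            gcongr
          have h3 := abs_sub_abs_le_abs_add (inner ℝ a v) (k / 2 * inner ℝ w v)
          nlinarith [norm_nonneg v]

theorem exists_uniform_functional (ι : Type) [Fintype ι] :
    ∃ c : ℝ, 0 < c ∧ ∀ {E : Type} [NormedAddCommGroup E] [InnerProductSpace ℝ E]
      (u : ι → E), ∃ a : E, ‖a‖ ≤ 1 ∧ ∀ i, c * ‖u i‖ ≤ |inner ℝ a (u i)| := by
  classical
  obtain ⟨c, hc, H⟩ := exists_uniform_functional_finset (Fintype.card ι)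
  refine ⟨c, hc, fun u => ?_⟩
  obtain ⟨a, ha, hau⟩ := H (Finset.univ.image u) Finset.card_image_le
  exact ⟨a, ha, fun i => hau _ (Finset.mem_image_of_mem u (Finset.mem_univ i))⟩

/-- The contraction of the bivector `u ∧ v` with `a` is comparable in norm to the area of the
parallelogram spanned by `u` and `v`. -/
theorem norm_contraction_bounds {E : Type} [NormedAddCommGroup E] [InnerProductSpace ℝ E]
    {a u v : E} {c : ℝ} (hc : 0 < c) (ha : ‖a‖ ≤ 1) (hu : u ≠ 0) (hau : c * ‖u‖ ≤ |inner ℝ a u|) :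
    let A := Real.sin (InnerProductGeometry.angle u v) * (‖u‖ * ‖v‖)
    c * A ≤ ‖inner ℝ a u • v - inner ℝ a v • u‖ ∧
      ‖inner ℝ a u • v - inner ℝ a v • u‖ ≤ 2 * A := by
  intro A
  have hA0 : 0 ≤ A := mul_nonneg (InnerProductGeometry.sin_angle_nonneg u v) (by positivity)
  have hA : A ^ 2 = ‖u‖ ^ 2 * ‖v‖ ^ 2 - inner ℝ u v ^ 2 := by
    have hG : 0 ≤ inner ℝ u u * inner ℝ v v - inner ℝ u v * inner ℝ u v :=
      sub_nonneg.mpr (real_inner_mul_inner_self_le u v)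
    simp only [A]
    rw [InnerProductGeometry.sin_angle_mul_norm_mul_norm, Real.sq_sqrt hG,
      real_inner_self_eq_norm_sq, real_inner_self_eq_norm_sq]
    ring
  have hun : 0 < ‖u‖ ^ 2 := by positivity
  set α := inner ℝ a u with hα
  set β := inner ℝ a v with hβ
  have hw : ‖α • v - β • u‖ ^ 2 = α ^ 2 * ‖v‖ ^ 2 - 2 * (α * β * inner ℝ u v) + β ^ 2 * ‖u‖ ^ 2 := by
    rw [norm_sub_sq_real, norm_smul, norm_smul, real_inner_smul_left, real_inner_smul_right,
      mul_pow, mul_pow, Real.norm_eq_abs, Real.norm_eq_abs, sq_abs, sq_abs, real_inner_comm u v]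
    ring
  -- Lagrange's identity for this vector and `u`, which span area `|α| * A`.
  have hkey : ‖α • v - β • u‖ ^ 2 * ‖u‖ ^ 2 =
      α ^ 2 * A ^ 2 + (α * inner ℝ u v - β * ‖u‖ ^ 2) ^ 2 := by
    rw [hw, hA]
    ring
  have hα1 : α ^ 2 ≤ ‖u‖ ^ 2 := by
    rw [← sq_abs α]
    have := (abs_real_inner_le_norm a u).trans (mul_le_of_le_one_left (norm_nonneg u) ha)
    gcongr
  have hα2 : c ^ 2 * ‖u‖ ^ 2 ≤ α ^ 2 := by
    rw [← sq_abs α, ← mul_pow]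
    gcongr
  -- The left side is the squared product of `a` with a vector orthogonal to `u` of length `‖u‖ *
  -- A`.
  have hcross : (α * inner ℝ u v - β * ‖u‖ ^ 2) ^ 2 ≤ ‖u‖ ^ 2 * A ^ 2 := by
    have h1 : α * inner ℝ u v - β * ‖u‖ ^ 2 = inner ℝ a (inner ℝ u v • u - ‖u‖ ^ 2 • v) := by
      rw [inner_sub_right, real_inner_smul_right, real_inner_smul_right]
      ring
    have h2 : ‖inner ℝ u v • u - ‖u‖ ^ 2 • v‖ ^ 2 = ‖u‖ ^ 2 * A ^ 2 := by
      rw [hA, norm_sub_sq_real, norm_smul, norm_smul, real_inner_smul_left, real_inner_smul_right,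
        mul_pow, mul_pow, Real.norm_eq_abs, Real.norm_eq_abs, sq_abs, sq_abs]
      ring
    rw [h1, ← h2, ← sq_abs]
    have := (abs_real_inner_le_norm a (inner ℝ u v • u - ‖u‖ ^ 2 • v)).trans
      (mul_le_of_le_one_left (norm_nonneg _) ha)
    gcongr
  constructor
  · refine le_of_sq_le_sq ?_ (norm_nonneg _)
    refine le_of_mul_le_mul_right ?_ hun
    rw [hkey, mul_pow]
    nlinarith [mul_le_mul_of_nonneg_right hα2 (sq_nonneg A),
      sq_nonneg (α * inner ℝ u v - β * ‖u‖ ^ 2)]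
  · refine le_of_sq_le_sq ?_ (by positivity)
    refine le_of_mul_le_mul_right ?_ hun
    rw [hkey, mul_pow]
    nlinarith [mul_le_mul_of_nonneg_right hα1 (sq_nonneg A), mul_nonneg hun.le (sq_nonneg A)]

/-- The difference of the slopes of the lines `p i p j` and `p k p j` of a planar family with
abscissae `x` and ordinates `y`. -/
noncomputable def slopeDiff {m : ℕ} (x y : Fin m → ℝ) (t : Fin m × Fin m × Fin m) : ℝ :=
  (y t.1 - y t.2.1) / (x t.1 - x t.2.1) - (y t.2.2 - y t.2.1) / (x t.2.2 - x t.2.1)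

/-- Points of a Euclidean space have a planar projection that separates distinct points and whose
slope differences are uniformly comparable to the sines of the angles between the points. -/
theorem exists_planar_projection (m : ℕ) :
    ∃ a b : ℝ, 0 < a ∧ ∀ {E : Type} [NormedAddCommGroup E] [InnerProductSpace ℝ E] (p : Fin m → E),
      ∃ x y : Fin m → ℝ, (∀ i j, p i ≠ p j → x i ≠ x j) ∧
        ∀ i j k, p i ≠ p j → p k ≠ p j →
          let S := Real.sin (InnerProductGeometry.angle (p i - p j) (p k - p j))
          a * S ≤ |slopeDiff x y (i, j, k)| ∧ |slopeDiff x y (i, j, k)| ≤ b * S := by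
  obtain ⟨c, hc, H⟩ := exists_uniform_functional (Fin m × Fin m)
  obtain ⟨c', hc', H'⟩ := exists_uniform_functional (Fin m × Fin m × Fin m)
  refine ⟨c' * c, 2 / c ^ 2, by positivity, fun p => ?_⟩
  obtain ⟨f, hf, hfu⟩ := H fun t => p t.1 - p t.2
  -- These vectors are, up to sign, the numerators of the slope differences before `g` is applied.
  obtain ⟨g, hg, hgu⟩ := H' fun t =>
    inner ℝ f (p t.1 - p t.2.1) • (p t.2.2 - p t.2.1) -
      inner ℝ f (p t.2.2 - p t.2.1) • (p t.1 - p t.2.1)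
  have hne : ∀ i j, p i ≠ p j → inner ℝ f (p i - p j) ≠ 0 := fun i j hij h => by
    have h1 := hfu (i, j)
    rw [h, abs_zero] at h1
    exact absurd h1 (not_le.mpr (mul_pos hc (norm_pos_iff.mpr (sub_ne_zero.mpr hij))))
  refine ⟨fun i => inner ℝ f (p i), fun i => inner ℝ g (p i), fun i j hij h => ?_,
    fun i j k hij hkj => ?_⟩
  · exact hne i j hij (by rw [inner_sub_right]; exact sub_eq_zero.mpr h)
  · intro S
    have hu0 := hne i j hij
    have hv0 := hne k j hkj
    have hfu' := hfu (i, j)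
    have hfv' := hfu (k, j)
    have hgw := hgu (i, j, k)
    dsimp only at hfu' hfv' hgw
    have hslope : slopeDiff (fun i => inner ℝ f (p i)) (fun i => inner ℝ g (p i)) (i, j, k) =
        -(inner ℝ g (inner ℝ f (p i - p j) • (p k - p j) - inner ℝ f (p k - p j) • (p i - p j))) /
          (inner ℝ f (p i - p j) * inner ℝ f (p k - p j)) := by
      simp only [slopeDiff, ← inner_sub_right]
      rw [inner_sub_right g (_ • _), real_inner_smul_right, real_inner_smul_right]
      field_simp
      ring
    obtain ⟨hlo, hhi⟩ := norm_contraction_bounds (v := p k - p j) hc hf (sub_ne_zero.mpr hij) hfu'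
    rw [hslope, abs_div, abs_neg, abs_mul]
    have hS0 : 0 ≤ S := InnerProductGeometry.sin_angle_nonneg _ _
    change c * (S * _) ≤ _ at hlo
    change _ ≤ 2 * (S * _) at hhi
    set w := inner ℝ f (p i - p j) • (p k - p j) - inner ℝ f (p k - p j) • (p i - p j)
    have hun : 0 < ‖p i - p j‖ := norm_pos_iff.mpr (sub_ne_zero.mpr hij)
    have hvn : 0 < ‖p k - p j‖ := norm_pos_iff.mpr (sub_ne_zero.mpr hkj)
    have hub := (abs_real_inner_le_norm f (p i - p j)).trans (mul_le_of_le_one_left hun.le hf)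
    have hvb := (abs_real_inner_le_norm f (p k - p j)).trans (mul_le_of_le_one_left hvn.le hf)
    have hwb := (abs_real_inner_le_norm g w).trans (mul_le_of_le_one_left (norm_nonneg w) hg)
    have hu1 := abs_pos.mpr hu0
    have hv1 := abs_pos.mpr hv0
    constructor
    · rw [le_div_iff₀ (mul_pos hu1 hv1)]
      calc c' * c * S * (|inner ℝ f (p i - p j)| * |inner ℝ f (p k - p j)|)
          ≤ c' * c * S * (‖p i - p j‖ * ‖p k - p j‖) := by gcongr
        _ = c' * (c * (S * (‖p i - p j‖ * ‖p k - p j‖))) := by ring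
        _ ≤ c' * ‖w‖ := by gcongr
        _ ≤ _ := hgw
    · rw [div_le_iff₀ (mul_pos hu1 hv1)]
      calc |inner ℝ g w| ≤ 2 * (S * (‖p i - p j‖ * ‖p k - p j‖)) := hwb.trans hhi
        _ = 2 / c ^ 2 * S * ((c * ‖p i - p j‖) * (c * ‖p k - p j‖)) := by field_simp
        _ ≤ _ := by gcongr

/-! ### Relations between slope differences -/

/-- A shear, a translation and a homothety move the points `i₀` and `j₀` to `(0, 0)` and `(1, 0)`
without changing slope differences. -/
theorem slopeDiff_normalize {m : ℕ} (x y : Fin m → ℝ) {i₀ j₀ : Fin m} (h : x i₀ ≠ x j₀)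
    {t : Fin m × Fin m × Fin m} (h1 : x t.1 ≠ x t.2.1) (h2 : x t.2.2 ≠ x t.2.1) :
    slopeDiff (fun k => (x k - x i₀) / (x j₀ - x i₀))
      (fun k => (y k - y i₀) / (x j₀ - x i₀) -
        (x k - x i₀) / (x j₀ - x i₀) * ((y j₀ - y i₀) / (x j₀ - x i₀))) t = slopeDiff x y t := by
  have h0 : x j₀ - x i₀ ≠ 0 := sub_ne_zero.mpr h.symm
  have h1' := sub_ne_zero.mpr h1
  have h2' := sub_ne_zero.mpr h2
  have e : ∀ k l, (x k - x i₀) / (x j₀ - x i₀) - (x l - x i₀) / (x j₀ - x i₀) =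
      (x k - x l) / (x j₀ - x i₀) := fun k l => by ring
  simp only [slopeDiff, e]
  field_simp
  ring

open MvPolynomial in
/-- Any `2m - 3` slope differences of `m` planar points satisfy a nontrivial polynomial relation. -/
theorem exists_slopeDiff_relation {m n : ℕ} (hn : 2 * m - 3 ≤ n) (i₀ j₀ : Fin m) (hij : i₀ ≠ j₀)
    (t : Fin n → Fin m × Fin m × Fin m) :
    ∃ Q : MvPolynomial (Fin n) ℝ, Q ≠ 0 ∧ ∀ x y : Fin m → ℝ, x i₀ ≠ x j₀ →
      (∀ i, x (t i).1 ≠ x (t i).2.1 ∧ x (t i).2.2 ≠ x (t i).2.1) →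
      eval (fun i => slopeDiff x y (t i)) Q = 0 := by
  let σ := {k : Fin m // k ≠ i₀ ∧ k ≠ j₀} × Bool
  have hcard : Fintype.card σ < n := by
    have h1 : Fintype.card {k : Fin m // k ≠ i₀ ∧ k ≠ j₀} + 2 = m := by
      have h2 : Finset.univ.filter (fun k : Fin m => k ≠ i₀ ∧ k ≠ j₀) =
          (Finset.univ.erase i₀).erase j₀ := by
        ext k
        simp [and_comm]
      rw [Fintype.card_subtype, h2, Finset.card_erase_of_mem (by simp [hij.symm]),
        Finset.card_erase_of_mem (Finset.mem_univ _), Finset.card_univ, Fintype.card_fin]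
      have := Fin.val_ne_of_ne hij
      omega
    rw [Fintype.card_prod, Fintype.card_bool]
    omega
  let X' : Fin m → MvPolynomial σ ℝ := fun k =>
    if h : k ≠ i₀ ∧ k ≠ j₀ then X (⟨k, h⟩, false) else if k = i₀ then 0 else 1
  let Y' : Fin m → MvPolynomial σ ℝ := fun k =>
    if h : k ≠ i₀ ∧ k ≠ j₀ then X (⟨k, h⟩, true) else 0
  obtain ⟨Q, hQ0, hQ⟩ := exists_relation_of_card_lt hcard
    (fun i => (Y' (t i).1 - Y' (t i).2.1) * (X' (t i).2.2 - X' (t i).2.1) -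
      (Y' (t i).2.2 - Y' (t i).2.1) * (X' (t i).1 - X' (t i).2.1))
    (fun i => (X' (t i).1 - X' (t i).2.1) * (X' (t i).2.2 - X' (t i).2.1))
  refine ⟨Q, hQ0, fun x y hx ht => ?_⟩
  have h0 : x j₀ - x i₀ ≠ 0 := sub_ne_zero.mpr hx.symm
  let x' : Fin m → ℝ := fun k => (x k - x i₀) / (x j₀ - x i₀)
  let y' : Fin m → ℝ := fun k => (y k - y i₀) / (x j₀ - x i₀) -
    (x k - x i₀) / (x j₀ - x i₀) * ((y j₀ - y i₀) / (x j₀ - x i₀))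
  let z : σ → ℝ := fun v => if v.2 then y' v.1 else x' v.1
  have hX : ∀ k, eval z (X' k) = x' k := fun k => by
    by_cases hi : k = i₀
    · simp [X', x', hi]
    · by_cases hj : k = j₀
      · simp [X', x', hj, hij.symm, div_self h0]
      · simp [X', z, hi, hj]
  have hY : ∀ k, eval z (Y' k) = y' k := fun k => by
    by_cases hi : k = i₀
    · simp [Y', y', hi]
    · by_cases hj : k = j₀
      · simp [Y', y', hj, div_self h0]
      · simp [Y', z, hi, hj]
  have hx' : ∀ k l, x k ≠ x l → x' k - x' l ≠ 0 := fun k l hkl => by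
    have : x' k - x' l = (x k - x l) / (x j₀ - x i₀) := by simp only [x']; ring
    rw [this]
    exact div_ne_zero (sub_ne_zero.mpr hkl) h0
  have hfin := hQ z fun i => by
    simp only [map_mul, map_sub, hX]
    exact mul_ne_zero (hx' _ _ (ht i).1) (hx' _ _ (ht i).2)
  rw [← hfin]
  congr 2
  funext i
  rw [← slopeDiff_normalize x y hx (ht i).1 (ht i).2]
  simp only [map_mul, map_sub, hX, hY]
  change slopeDiff x' y' (t i) = _
  rw [slopeDiff, div_sub_div _ _ (hx' _ _ (ht i).1) (hx' _ _ (ht i).2)]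
  ring

/-- One nonzero polynomial controls all choices of the index triples: if every triple spans
nondegenerate slopes, it vanishes at the slope differences. -/
theorem exists_universal_slopeDiff_relation (m : ℕ) {n : ℕ} (hn : 2 * m - 3 ≤ n) (hn0 : 0 < n) :
    ∃ Q : MvPolynomial (Fin n) ℝ, Q ≠ 0 ∧ ∀ (x y : Fin m → ℝ) (t : Fin n → Fin m × Fin m × Fin m),
      (∀ i, x (t i).1 ≠ x (t i).2.1 ∧ x (t i).2.2 ≠ x (t i).2.1) →
      MvPolynomial.eval (fun i => slopeDiff x y (t i)) Q = 0 := by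
  have key : ∀ t : Fin n → Fin m × Fin m × Fin m, ∃ Q : MvPolynomial (Fin n) ℝ, Q ≠ 0 ∧
      ∀ x y : Fin m → ℝ, (∀ i, x (t i).1 ≠ x (t i).2.1 ∧ x (t i).2.2 ≠ x (t i).2.1) →
      MvPolynomial.eval (fun i => slopeDiff x y (t i)) Q = 0 := fun t => by
    by_cases h : (t ⟨0, hn0⟩).1 = (t ⟨0, hn0⟩).2.1
    -- A degenerate first triple satisfies no hypothesis, so any nonzero polynomial serves.
    · exact ⟨1, one_ne_zero, fun x y ht => absurd (congrArg x h) (ht _).1⟩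
    · obtain ⟨Q, hQ0, hQ⟩ := exists_slopeDiff_relation hn _ _ h t
      exact ⟨Q, hQ0, fun x y ht => hQ x y (ht _).1 ht⟩
  choose Q hQ0 hQ using key
  refine ⟨∏ t, Q t, Finset.prod_ne_zero_iff.mpr fun t _ => hQ0 t, fun x y t ht => ?_⟩
  rw [map_prod]
  exact Finset.prod_eq_zero (Finset.mem_univ t) (hQ t x y ht)

theorem theorem2 (m n : ℕ) (hm : 2 ≤ m) (hn : n = 2 * m - 3) :
    ∃ S : Finset ℝ, S.card = n ∧ (∀ θ ∈ S, 0 < θ ∧ θ < Real.pi) ∧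
      ∀ (d : ℕ) (p : Fin m → EuclideanSpace ℝ (Fin d)), ¬ ∀ θ ∈ S, RealisesAngle p θ := by
  obtain ⟨a, b, ha, hproj⟩ := exists_planar_projection m
  obtain ⟨Q, hQ0, hQ⟩ := exists_universal_slopeDiff_relation m hn.ge (by omega)
  obtain ⟨e, hinj, he, hsep⟩ := exists_separated_scales a b ha Q hQ0
  have hsin : ∀ i, Real.sin (Real.arcsin (e i)) = e i := fun i =>
    Real.sin_arcsin (by linarith [(he i).1]) (he i).2.le
  have hinj' : Function.Injective fun i => Real.arcsin (e i) := fun i j hij => hinj (by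
    rw [← hsin i, ← hsin j]
    exact congrArg Real.sin hij)
  refine ⟨Finset.univ.image fun i => Real.arcsin (e i), ?_, ?_, fun d p hp => ?_⟩
  · rw [Finset.card_image_of_injective _ hinj', Finset.card_univ, Fintype.card_fin]
  · intro θ hθ
    obtain ⟨i, -, rfl⟩ := Finset.mem_image.mp hθ
    exact ⟨Real.arcsin_pos.mpr (he i).1,
      (Real.arcsin_le_pi_div_two _).trans_lt (by linarith [Real.pi_pos])⟩
  · have hreal : ∀ i, RealisesAngle p (Real.arcsin (e i)) := fun i =>
      hp _ (Finset.mem_image_of_mem _ (Finset.mem_univ i))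
    choose A B C hA hC hang using hreal
    obtain ⟨x, y, hx, hxy⟩ := hproj p
    refine hsep (fun i => slopeDiff x y (A i, B i, C i)) (fun i => ?_)
      (hQ x y (fun i => (A i, B i, C i)) fun i => ⟨hx _ _ (hA i), hx _ _ (hC i)⟩)
    have h := hxy (A i) (B i) (C i) (hA i) (hC i)
    have hang' : InnerProductGeometry.angle (p (A i) - p (B i)) (p (C i) - p (B i)) =
        Real.arcsin (e i) := hang i
    rw [hang', hsin] at h
    exact h
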